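/- **Proposition 3.7.** Let $E$ be a Banach space over $\mathbb{K}=\mathbb{R}$ or $\mathbb{C}$ and let $n\ge 1$. Let $\mathcal{P}({}^nE)$ be the space of continuous $n$-homogeneous polynomials $P:E\to\mathbb{K}$, i.e. the functions $P(x)=L(x,\dots,x)$ with $L$ a continuous $n$-linear form on $E$, with the norm $\|P\|=\sup_{\|x\|\le1}|P(x)|$, and let $\mathcal{P}_w({}^nE)$ be the subspace of those $P$ that are weakly continuous on bounded sets, i.e. whose restriction to every bounded subset of $E$ is continuous for the relative weak topology. Suppose that $\mathcal{P}_w({}^nE)$ is an M-ideal in $\mathcal{P}({}^nE)$; here a closed subspace $J$ of a Banach space $X$ is an M-ideal in $X$ if there is a closed subspace $J^\sharp$ of $X^*$ such that $X^*=J^\perp\oplus J^\sharp$ and $\|\varphi+\psi\|=\|\varphi\|+\|\psi\|$ for all $\varphi\in J^\perp$, $\psi\in J^\sharp$, where $J^\perp=\{\varphi\in X^*:\varphi|_J=0\}$. Then $E$ has the $n$-polynomial property (M): for every $P\in\mathcal{P}({}^nE)$ with $\|P\|\le1$, all $\lambda\in\mathbb{K}$ and $v\in E$ with $|\lambda|\le\|v\|^n$,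 and every bounded weakly null net $(x_\alpha)_\alpha$ in $E$, $$\limsup_\alpha|\lambda+P(x_\alpha)|\le\limsup_\alpha\|v+x_\alpha\|^n.$$ -/

import Mathlib

open Filter Topology

universe u v w

section Polynomials

/-- The functions `P : E → 𝕜` of the form `P x = L (x, …, x)` for some continuous `n`-linear
form `L` on `E`, as a vector space under the pointwise operations. -/
def homPolySubmodule (𝕜 : Type u) (E : Type v) [RCLike 𝕜] [NormedAddCommGroup E]
    [NormedSpace 𝕜 E] (n : ℕ) : Submodule 𝕜 (E → 𝕜) where
  carrier := {P | ∃ L : ContinuousMultilinearMap 𝕜 (fun _ : Fin n => E) 𝕜,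
    ∀ x, P x = L (fun _ => x)}
  add_mem' := by
    rintro P Q ⟨L, hL⟩ ⟨M, hM⟩
    exact ⟨L + M, fun x => by simp [hL, hM]⟩
  zero_mem' := ⟨0, fun x => by simp⟩
  smul_mem' := by
    rintro c P ⟨L, hL⟩
    exact ⟨c • L, fun x => by simp [hL]⟩

/-- The space of continuous scalar-valued `n`-homogeneous polynomials on `E`. It is a type of its
own, so that it carries the topology of the sup norm over the unit ball of `E` and not the
topology of pointwise convergence. -/
def HomPoly (𝕜 : Type u) (E : Type v) [RCLike 𝕜] [NormedAddCommGroup E]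
    [NormedSpace 𝕜 E] (n : ℕ) : Type (max u v) :=
  ↥(homPolySubmodule 𝕜 E n)

namespace HomPoly

variable {𝕜 : Type u} {E : Type v} [RCLike 𝕜] [NormedAddCommGroup E] [NormedSpace 𝕜 E] {n : ℕ}

instance : AddCommGroup (HomPoly 𝕜 E n) := inferInstanceAs (AddCommGroup (homPolySubmodule 𝕜 E n))

instance : Module 𝕜 (HomPoly 𝕜 E n) := inferInstanceAs (Module 𝕜 (homPolySubmodule 𝕜 E n))

instance : FunLike (HomPoly 𝕜 E n) E 𝕜 where
  coe P := Subtype.val P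
  coe_injective := Subtype.val_injective

@[ext] theorem ext {P Q : HomPoly 𝕜 E n} (h : ∀ x, P x = Q x) : P = Q := DFunLike.ext _ _ h

@[simp] theorem add_apply (P Q : HomPoly 𝕜 E n) (x : E) : (P + Q) x = P x + Q x := rfl

@[simp] theorem smul_apply (c : 𝕜) (P : HomPoly 𝕜 E n) (x : E) : (c • P) x = c * P x := rfl

@[simp] theorem zero_apply (x : E) : (0 : HomPoly 𝕜 E n) x = 0 := rfl

theorem exists_multilinear (P : HomPoly 𝕜 E n) :
    ∃ L : ContinuousMultilinearMap 𝕜 (fun _ : Fin n => E) 𝕜, ∀ x, P x = L (fun _ => x) :=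
  Subtype.property P

theorem map_smul_pow (P : HomPoly 𝕜 E n) (c : 𝕜) (x : E) : P (c • x) = c ^ n * P x := by
  obtain ⟨L, hL⟩ := P.exists_multilinear
  rw [hL, hL]
  simpa using L.map_smul_univ (fun _ => c) (fun _ => x)

/-- The norm `‖P‖ = sup {|P x| : ‖x‖ ≤ 1}`. -/
noncomputable instance : Norm (HomPoly 𝕜 E n) where
  norm P := ⨆ x : Metric.closedBall (0 : E) 1, ‖P x‖

theorem norm_def (P : HomPoly 𝕜 E n) : ‖P‖ = ⨆ x : Metric.closedBall (0 : E) 1, ‖P x‖ := rfl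

theorem bddAbove_range_norm (P : HomPoly 𝕜 E n) :
    BddAbove (Set.range fun x : Metric.closedBall (0 : E) 1 => ‖P x‖) := by
  obtain ⟨L, hL⟩ := P.exists_multilinear
  refine ⟨‖L‖, ?_⟩
  rintro _ ⟨⟨x, hx⟩, rfl⟩
  have hx' : ‖x‖ ≤ 1 := by simpa using hx
  simp only [hL]
  exact L.unit_le_opNorm ((pi_norm_le_iff_of_nonneg zero_le_one).2 fun _ => hx')

theorem norm_apply_le_of_norm_le_one (P : HomPoly 𝕜 E n) {x : E} (hx : ‖x‖ ≤ 1) :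
    ‖P x‖ ≤ ‖P‖ :=
  le_ciSup P.bddAbove_range_norm ⟨x, by simpa using hx⟩

instance : Nonempty (Metric.closedBall (0 : E) 1) := ⟨⟨0, by simp⟩⟩

theorem normedSpaceCore : NormedSpace.Core 𝕜 (HomPoly 𝕜 E n) where
  norm_nonneg P := Real.iSup_nonneg fun _ => norm_nonneg _
  norm_smul c P := by
    simp only [norm_def, smul_apply, norm_mul]
    exact (Real.mul_iSup_of_nonneg (norm_nonneg c) _).symm
  norm_triangle P Q := by
    refine ciSup_le fun x => ?_
    have hx : ‖(x : E)‖ ≤ 1 := mem_closedBall_zero_iff.1 x.2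
    exact (norm_add_le _ _).trans
      (add_le_add (P.norm_apply_le_of_norm_le_one hx) (Q.norm_apply_le_of_norm_le_one hx))
  norm_eq_zero_iff P := by
    constructor
    · intro h
      ext x
      have key : ∀ y : E, ‖y‖ ≤ 1 → P y = 0 := fun y hy =>
        norm_le_zero_iff.1 (h ▸ P.norm_apply_le_of_norm_le_one hy)
      rcases eq_or_ne x 0 with rfl | hx
      · exact key 0 (by simp)
      · have hx' : ((‖x‖ : ℝ) : 𝕜) ≠ 0 := by simpa using hx
        have hy := key ((((‖x‖ : ℝ) : 𝕜)⁻¹) • x) (by simp [norm_smul, hx])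
        rw [map_smul_pow] at hy
        simpa [hx] using hy
    · rintro rfl
      simp [norm_def]

noncomputable instance : NormedAddCommGroup (HomPoly 𝕜 E n) :=
  NormedAddCommGroup.ofCore (𝕜 := 𝕜) normedSpaceCore

noncomputable instance : NormedSpace 𝕜 (HomPoly 𝕜 E n) :=
  NormedSpace.ofCore normedSpaceCore

/-- The subspace of the `n`-homogeneous polynomials on `E` that are weakly continuous on bounded
sets: the restriction of `P` to each bounded set `B` is continuous for the topology that the weak
topology of `E` induces on `B`. -/
def weaklyContinuous (𝕜 : Type u) (E : Type v) [RCLike 𝕜] [NormedAddCommGroup E]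
    [NormedSpace 𝕜 E] (n : ℕ) : Submodule 𝕜 (HomPoly 𝕜 E n) where
  carrier := {P | ∀ B : Set E, Bornology.IsBounded B →
    ContinuousOn (fun y : WeakSpace 𝕜 E => P ((toWeakSpace 𝕜 E).symm y)) (toWeakSpace 𝕜 E '' B)}
  add_mem' := fun hP hQ B hB => (hP B hB).add (hQ B hB)
  zero_mem' := fun _ _ => continuousOn_const
  smul_mem' := fun _ _ hP B hB => continuousOn_const.mul (hP B hB)

/-- Property (M) of the polynomial `P`. Nets are families indexed by nonempty directed preorders;
since they are bounded, both sides are limits superior of bounded real nets. -/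
def HasPropertyM (P : HomPoly 𝕜 E n) : Prop :=
  ∀ (c : 𝕜) (e : E), ‖c‖ ≤ ‖e‖ ^ n →
    ∀ (ι : Type w) [Preorder ι] [IsDirectedOrder ι] [Nonempty ι] (x : ι → E),
      Bornology.IsBounded (Set.range x) →
      Tendsto (fun i => toWeakSpace 𝕜 E (x i)) atTop (𝓝 0) →
      limsup (fun i => ‖c + P (x i)‖) atTop ≤ limsup (fun i => ‖e + x i‖ ^ n) atTop

end HomPoly

/-- The `n`-polynomial property (M) of `E`, for nets with index sets in `Type w`. -/
def HasPolynomialPropertyM (𝕜 : Type u) (E : Type v) [RCLike 𝕜] [NormedAddCommGroup E]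
    [NormedSpace 𝕜 E] (n : ℕ) : Prop :=
  ∀ P : HomPoly 𝕜 E n, ‖P‖ ≤ 1 → HomPoly.HasPropertyM.{u, v, w} P

end Polynomials

section MIdeals

variable {𝕜 : Type u} {X : Type v} [RCLike 𝕜] [NormedAddCommGroup X] [NormedSpace 𝕜 X]

/-- The annihilator of `J` in the topological dual of `X`. -/
def topAnnihilator (J : Submodule 𝕜 X) : Submodule 𝕜 (StrongDual 𝕜 X) where
  carrier := {φ | ∀ x ∈ J, φ x = 0}
  add_mem' := fun {φ ψ} hφ hψ x hx => by simp [hφ x hx, hψ x hx]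
  zero_mem' := fun _ _ => rfl
  smul_mem' := fun c φ hφ x hx => by simp [hφ x hx]

/-- `J` is an M-ideal in `X`: it is closed, and the dual of `X` is the `ℓ₁`-direct sum of the
annihilator of `J` and some closed subspace `K`. -/
def IsMIdeal (J : Submodule 𝕜 X) : Prop :=
  IsClosed (J : Set X) ∧
    ∃ K : Submodule 𝕜 (StrongDual 𝕜 X), IsClosed (K : Set (StrongDual 𝕜 X)) ∧
      IsCompl (topAnnihilator J) K ∧
      ∀ φ ∈ topAnnihilator J, ∀ ψ ∈ K, ‖φ + ψ‖ = ‖φ‖ + ‖ψ‖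

end MIdeals

/-! Write `J` for the polynomials weakly continuous on bounded sets. Along an ultrafilter,
evaluation at `x i` and at `v + x i` has weak-star limits `Ψ` and `Φ`. Since `x` is bounded and
weakly null, `Ψ` annihilates `J`. Evaluation at `v` lies in the complementary summand, because it
attains its norm on `J` at a power of a functional norming `v` (`evalAt_mem`). Once `Φ = Ψ + evalAt
𝕜 n v` is known, the ℓ₁-decomposition gives `‖c + Ψ P‖ ≤ ‖v‖ ^ n + ‖Ψ‖ = ‖Φ‖`, and `‖Φ‖` is at most
the limsup of `‖v + x i‖ ^ n`.

That identity is `tendsto_add_sub`: `P (v + x i) - P (x i)` tends to `P v`. Let `Q` be `P` composed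
with the projection along `v` onto the kernel of a functional. Then `P - Q` is weakly continuous at
`0` on the unit ball, and the M-ideal hypothesis upgrades this to `P - Q ∈ J`
(`mem_weaklyContinuous_of_tendsto_zero`).

For the upgrade, by Krein–Milman and Hahn–Banach it suffices to test on extreme points of the ball
of the annihilator. The nonzero ones are extreme in the whole dual ball, hence by Milman are limits
of rotated evaluations. Vanishing on powers of functionals forces the evaluation points to be weakly
null. -/

/-! ### Milman's converse to the Krein–Milman theorem -/

section Milman

variable {V : Type*} [AddCommGroup V] [Module ℝ V] [TopologicalSpace V]
  [IsTopologicalAddGroup V] [ContinuousSMul ℝ V]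

theorem isCompact_convexJoin {s t : Set V} (hs : IsCompact s) (ht : IsCompact t) :
    IsCompact (convexJoin ℝ s t) := by
  have h : convexJoin ℝ s t =
      (fun q : (V × V) × ℝ => (1 - q.2) • q.1.1 + q.2 • q.1.2) ''
        ((s ×ˢ t) ×ˢ Set.Icc (0 : ℝ) 1) := by
    ext x
    simp only [mem_convexJoin, segment_eq_image, Set.mem_image, Set.mem_prod, Prod.exists]
    constructor
    · rintro ⟨a, ha, b, hb, r, hr, rfl⟩
      exact ⟨a, b, r, ⟨⟨ha, hb⟩, hr⟩, rfl⟩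
    · rintro ⟨a, b, r, ⟨⟨ha, hb⟩, hr⟩, rfl⟩
      exact ⟨a, ha, b, hb, r, hr, rfl⟩
  rw [h]
  exact ((hs.prod ht).prod isCompact_Icc).image (by fun_prop)

/-- By induction: the hull of the union of two nonempty convex sets is their convex join, so no
closure is needed. -/
theorem isCompact_convexHull_biUnion {ι : Type*} (s : Finset ι) (C : ι → Set V)
    (hC : ∀ i ∈ s, IsCompact (C i)) (hconv : ∀ i ∈ s, Convex ℝ (C i)) :
    IsCompact (convexHull ℝ (⋃ i ∈ s, C i)) := by
  classical
  induction s using Finset.induction_on with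
  | empty => simp
  | insert a s _ ih =>
    have ih := ih (fun i hi => hC i (Finset.mem_insert_of_mem hi))
      (fun i hi => hconv i (Finset.mem_insert_of_mem hi))
    have ha := hC a (Finset.mem_insert_self a s)
    have ha' := hconv a (Finset.mem_insert_self a s)
    rw [Finset.set_biUnion_insert]
    rcases (C a).eq_empty_or_nonempty with h | hne
    · simpa [h] using ih
    rcases (⋃ i ∈ s, C i).eq_empty_or_nonempty with h | hne'
    · rw [h, Set.union_empty, ha'.convexHull_eq]
      exact ha
    rw [← convexHull_convexHull_union_right,
      ha'.convexHull_union (convex_convexHull ℝ _) hne hne'.convexHull]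
    exact isCompact_convexJoin ha ih

/-- **Milman's theorem**: the extreme points of a compact convex set that is the closed convex hull
of a set `A` belong to the closure of `A`. -/
theorem extremePoints_subset_closure [LocallyConvexSpace ℝ V] [T2Space V] {A B : Set V}
    (hB : IsCompact B) (hconv : Convex ℝ B) (hAB : A ⊆ B)
    (hBA : B ⊆ closure (convexHull ℝ A)) : B.extremePoints ℝ ⊆ closure A := by
  classical
  intro x hx
  by_contra hxA
  have hA : IsCompact (closure A) :=
    hB.of_isClosed_subset isClosed_closure (closure_minimal hAB hB.isClosed)
  have hsep : ∀ y : V, ∃ f : StrongDual ℝ V, y ∈ closure A → f y < f x := by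
    intro y
    by_cases hy : y ∈ closure A
    · obtain ⟨f, hf⟩ := geometric_hahn_banach_point_point (x := y) (y := x)
        (fun h => hxA (h ▸ hy))
      exact ⟨f, fun _ => hf⟩
    · exact ⟨0, fun h => (hy h).elim⟩
  choose f hf using hsep
  obtain ⟨s, hsA, hs⟩ := hA.elim_nhds_subcover (fun y => {z | f y z < (f y y + f y x) / 2})
    (fun y hy => by
      refine (isOpen_lt (f y).continuous continuous_const).mem_nhds ?_
      have := hf y hy
      change f y y < (f y y + f y x) / 2
      linarith)
  -- Finitely many compact convex slices of `B` cover `A`, and each misses `x`: the threshold is the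
  -- midpoint between `f y y` and the larger value `f y x`.
  set C : V → Set V := fun y => B ∩ {z | f y z ≤ (f y y + f y x) / 2} with hCdef
  have hCc : ∀ y, IsCompact (C y) := fun y =>
    hB.inter_right (isClosed_le (f y).continuous continuous_const)
  have hCv : ∀ y, Convex ℝ (C y) := fun y =>
    hconv.inter (convex_halfSpace_le (f y).toLinearMap.isLinear _)
  have hAC : A ⊆ ⋃ y ∈ s, C y := by
    intro z hz
    obtain ⟨y, hy, hzy⟩ := Set.mem_iUnion₂.1 (hs (subset_closure hz))
    exact Set.mem_iUnion₂.2 ⟨y, hy, hAB hz, le_of_lt (show f y z < (f y y + f y x) / 2 from hzy)⟩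
  have hH : convexHull ℝ (⋃ y ∈ s, C y) = B := by
    apply Set.Subset.antisymm
    · exact convexHull_min (Set.iUnion₂_subset fun y _ => Set.inter_subset_left) hconv
    · exact hBA.trans (closure_minimal (convexHull_mono hAC)
        (isCompact_convexHull_biUnion s C (fun y _ => hCc y) (fun y _ => hCv y)).isClosed)
  rw [← hH] at hx
  obtain ⟨y, hy, hxy⟩ := Set.mem_iUnion₂.1 (extremePoints_convexHull_subset hx)
  have h1 := hf y (hsA y hy)
  have h2 : f y x ≤ (f y y + f y x) / 2 := hxy.2
  linarith

end Milman

/-! ### Norming sets and the weak-star dual ball -/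

section WeakStar

variable {𝕜 : Type u} {X : Type v} [RCLike 𝕜] [NormedAddCommGroup X] [NormedSpace 𝕜 X]

instance WeakDual.isScalarTower_real : IsScalarTower ℝ 𝕜 (WeakDual 𝕜 X) :=
  inferInstanceAs (IsScalarTower ℝ 𝕜 (X →L[𝕜] 𝕜))

instance WeakDual.locallyConvexSpace_real : LocallyConvexSpace ℝ (WeakDual 𝕜 X) :=
  inferInstanceAs (LocallyConvexSpace ℝ (WeakBilin (topDualPairing 𝕜 X)))

theorem WeakDual.exists_eval_eq (f : StrongDual 𝕜 (WeakDual 𝕜 X)) :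
    ∃ x : X, ∀ φ : WeakDual 𝕜 X, f φ = φ x := by
  obtain ⟨x, hx⟩ := LinearMap.dualEmbedding_surjective (topDualPairing 𝕜 X) f
  exact ⟨x, fun φ => (DFunLike.congr_fun hx φ).symm⟩

/-- The closed unit ball of the dual of `X`, as a subset of the weak-star dual. -/
def dualUnitBall (𝕜 : Type u) (X : Type v) [RCLike 𝕜] [NormedAddCommGroup X] [NormedSpace 𝕜 X] :
    Set (WeakDual 𝕜 X) :=
  WeakDual.toStrongDual ⁻¹' Metric.closedBall 0 1

theorem mem_dualUnitBall {φ : WeakDual 𝕜 X} :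
    φ ∈ dualUnitBall 𝕜 X ↔ ‖WeakDual.toStrongDual φ‖ ≤ 1 := by
  simp [dualUnitBall]

theorem isCompact_dualUnitBall : IsCompact (dualUnitBall 𝕜 X) :=
  WeakDual.isCompact_closedBall 0 1

theorem convex_dualUnitBall : Convex ℝ (dualUnitBall 𝕜 X) := by
  intro φ hφ ψ hψ a b ha hb hab
  exact convex_closedBall (0 : StrongDual 𝕜 X) 1 hφ hψ ha hb hab

/-- A set of functionals in the dual unit ball that is norming has the dual unit ball as the
weak-star closed convex hull of its rotations. -/
theorem dualUnitBall_subset_closure_convexHull {A : Set (WeakDual 𝕜 X)}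
    (hrot : ∀ c : 𝕜, ‖c‖ = 1 → ∀ φ ∈ A, c • φ ∈ A)
    (hnorm : ∀ (x : X) (r : ℝ), (∀ φ ∈ A, ‖φ x‖ ≤ r) → ‖x‖ ≤ r) :
    dualUnitBall 𝕜 X ⊆ closure (convexHull ℝ A) := by
  intro Φ hΦ
  by_contra hn
  obtain ⟨f, r, hr, hfr⟩ := RCLike.geometric_hahn_banach_closed_point (𝕜 := 𝕜)
    (convex_convexHull ℝ A).closure isClosed_closure hn
  obtain ⟨x, hx⟩ := WeakDual.exists_eval_eq f
  have hxr : ‖x‖ ≤ r := by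
    refine hnorm x r fun φ hφ => ?_
    -- Rotating `φ` makes its value at `x` equal to `‖φ x‖`, so a bound on real parts bounds the
    -- modulus.
    obtain ⟨c, hc, hcx⟩ := RCLike.exists_norm_eq_mul_self (φ x)
    have h1 := hr (c • φ) (subset_closure (subset_convexHull ℝ A (hrot c hc φ hφ)))
    rw [map_smul, hx, smul_eq_mul, ← hcx, RCLike.ofReal_re] at h1
    exact h1.le
  have h2 : RCLike.re (f Φ) ≤ ‖x‖ := by
    rw [hx]
    refine (RCLike.re_le_norm _).trans ?_
    exact (WeakDual.toStrongDual Φ).le_of_opNorm_le (mem_dualUnitBall.1 hΦ) x |>.trans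
      (by simp)
  linarith

/-- The extreme points of the dual unit ball are weak-star limits of elements of any norming set
that is invariant under rotations. -/
theorem extremePoints_dualUnitBall_subset_closure {A : Set (WeakDual 𝕜 X)}
    (hA : A ⊆ dualUnitBall 𝕜 X) (hrot : ∀ c : 𝕜, ‖c‖ = 1 → ∀ φ ∈ A, c • φ ∈ A)
    (hnorm : ∀ (x : X) (r : ℝ), (∀ φ ∈ A, ‖φ x‖ ≤ r) → ‖x‖ ≤ r) :
    (dualUnitBall 𝕜 X).extremePoints ℝ ⊆ closure A := by
  have key := @extremePoints_subset_closure (WeakDual 𝕜 X) _ _ _ _ _ _ _ A (dualUnitBall 𝕜 X)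
  intro x hx
  refine key isCompact_dualUnitBall ?_ hA ?_ ?_
  · exact convex_dualUnitBall
  · exact dualUnitBall_subset_closure_convexHull hrot hnorm
  · exact hx

end WeakStar

/-! ### Extreme points of the ball of an L-summand -/

section LSummand

variable {𝕜 : Type u} {X : Type v} [RCLike 𝕜] [NormedAddCommGroup X] [NormedSpace 𝕜 X]

theorem exists_mem_add_mem {J : Submodule 𝕜 X} {K : Submodule 𝕜 (StrongDual 𝕜 X)}
    (hK : IsCompl (topAnnihilator J) K) (φ : StrongDual 𝕜 X) :
    ∃ a ∈ topAnnihilator J, ∃ b ∈ K, φ = a + b := by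
  have : φ ∈ topAnnihilator J ⊔ K := by rw [hK.sup_eq_top]; trivial
  obtain ⟨a, ha, b, hb, h⟩ := Submodule.mem_sup.1 this
  exact ⟨a, ha, b, hb, h.symm⟩

/-- Points of `J` see only the `K`-component `b` of `φ = a + b`, so `‖a‖ + ‖b‖ ≤ ‖b‖` and `a = 0`.
-/
theorem mem_of_exists_norm_le {J : Submodule 𝕜 X} {K : Submodule 𝕜 (StrongDual 𝕜 X)}
    (hK : IsCompl (topAnnihilator J) K)
    (hL : ∀ φ ∈ topAnnihilator J, ∀ ψ ∈ K, ‖φ + ψ‖ = ‖φ‖ + ‖ψ‖)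
    {φ : StrongDual 𝕜 X} (hφ : ∃ x ∈ J, ‖x‖ ≤ 1 ∧ ‖φ‖ ≤ ‖φ x‖) : φ ∈ K := by
  obtain ⟨a, ha, b, hb, rfl⟩ := exists_mem_add_mem hK φ
  obtain ⟨x, hx, hx1, hle⟩ := hφ
  rw [hL a ha b hb, add_apply, ha x hx, zero_add] at hle
  have h1 : ‖b x‖ ≤ ‖b‖ := b.unit_le_opNorm x hx1
  have h2 : a = 0 := norm_le_zero_iff.1 (by linarith)
  simpa [h2] using hb

/-- The unit ball of the annihilator of `J`, as a subset of the weak-star dual. -/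
def annihilatorBall (J : Submodule 𝕜 X) : Set (WeakDual 𝕜 X) :=
  dualUnitBall 𝕜 X ∩ {φ | ∀ x ∈ J, φ x = 0}

theorem isCompact_annihilatorBall (J : Submodule 𝕜 X) : IsCompact (annihilatorBall J) := by
  refine isCompact_dualUnitBall.inter_right ?_
  simp only [Set.ofPred_forall]
  exact isClosed_biInter fun x _ => isClosed_eq (WeakDual.eval_continuous x) continuous_const

theorem convex_annihilatorBall (J : Submodule 𝕜 X) : Convex ℝ (annihilatorBall J) := by
  refine convex_dualUnitBall.inter ?_
  intro φ hφ ψ hψ a b _ _ _ x hx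
  change a • φ x + b • ψ x = 0
  rw [hφ x hx, hψ x hx, smul_zero, smul_zero, add_zero]

theorem closure_convexHull_extremePoints_annihilatorBall (J : Submodule 𝕜 X) :
    closure (convexHull ℝ ((annihilatorBall J).extremePoints ℝ)) = annihilatorBall J := by
  have hc := isCompact_annihilatorBall J
  have hv := convex_annihilatorBall J
  exact closure_convexHull_extremePoints hc hv

/-- Nonzero extreme points of the unit ball of an L-summand are extreme in the whole ball. -/
theorem extremePoints_annihilatorBall {J : Submodule 𝕜 X} {K : Submodule 𝕜 (StrongDual 𝕜 X)}
    (hK : IsCompl (topAnnihilator J) K)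
    (hL : ∀ φ ∈ topAnnihilator J, ∀ ψ ∈ K, ‖φ + ψ‖ = ‖φ‖ + ‖ψ‖)
    {Φ : WeakDual 𝕜 X} (hΦ : Φ ∈ (annihilatorBall J).extremePoints ℝ) (h0 : Φ ≠ 0) :
    Φ ∈ (dualUnitBall 𝕜 X).extremePoints ℝ := by
  have hmem := hΦ.1
  have hpos : 0 < ‖WeakDual.toStrongDual Φ‖ := by
    rw [norm_pos_iff]
    simpa using h0
  -- Otherwise `Φ` lies strictly between `0` and its normalization, both in the annihilator ball.
  have hone : ‖WeakDual.toStrongDual Φ‖ = 1 := by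
    by_contra hne
    have hlt := lt_of_le_of_ne (mem_dualUnitBall.1 hmem.1) hne
    set r := ‖WeakDual.toStrongDual Φ‖ with hr
    have hz : (0 : WeakDual 𝕜 X) ∈ annihilatorBall J :=
      ⟨mem_dualUnitBall.2 (by simp), fun x _ => rfl⟩
    have hs : (r⁻¹ • Φ) ∈ annihilatorBall J := by
      refine ⟨mem_dualUnitBall.2 ?_, fun x hx => ?_⟩
      · change ‖r⁻¹ • WeakDual.toStrongDual Φ‖ ≤ 1
        rw [norm_smul, ← hr, norm_inv, Real.norm_of_nonneg hpos.le, inv_mul_cancel₀ hpos.ne']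
      · change r⁻¹ • Φ x = 0
        rw [hmem.2 x hx, smul_zero]
    refine h0 (hΦ.2 hz hs ⟨1 - r, r, by linarith, hpos, by ring, ?_⟩).symm
    rw [smul_zero, zero_add, smul_smul, mul_inv_cancel₀ hpos.ne', one_smul]
  refine ⟨hmem.1, ?_⟩
  rintro φ₁ h₁ φ₂ h₂ ⟨s, t, hs, ht, hst, hsum⟩
  obtain ⟨a₁, ha₁, b₁, hb₁, e₁⟩ := exists_mem_add_mem hK (WeakDual.toStrongDual φ₁)
  obtain ⟨a₂, ha₂, b₂, hb₂, e₂⟩ := exists_mem_add_mem hK (WeakDual.toStrongDual φ₂)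
  have n₁ := mem_dualUnitBall.1 h₁
  have n₂ := mem_dualUnitBall.1 h₂
  rw [e₁, hL a₁ ha₁ b₁ hb₁] at n₁
  rw [e₂, hL a₂ ha₂ b₂ hb₂] at n₂
  have hsum' : s • (a₁ + b₁) + t • (a₂ + b₂) = WeakDual.toStrongDual Φ := by
    rw [← e₁, ← e₂, ← hsum]
    rfl
  have hreal : ∀ (r : ℝ) (φ : StrongDual 𝕜 X), r • φ = (r : 𝕜) • φ := by
    intro r φ
    ext x
    simp [RCLike.real_smul_eq_coe_mul]
  -- As `Φ` annihilates `J`, the `K`-components cancel in the convex combination.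
  have hΦa : s • a₁ + t • a₂ = WeakDual.toStrongDual Φ := by
    have hm : (WeakDual.toStrongDual Φ - (s • a₁ + t • a₂)) ∈ topAnnihilator J ⊓ K := by
      constructor
      · refine Submodule.sub_mem _ (fun x hx => hmem.2 x hx) ?_
        rw [hreal, hreal]
        exact Submodule.add_mem _ (Submodule.smul_mem _ _ ha₁) (Submodule.smul_mem _ _ ha₂)
      · have : WeakDual.toStrongDual Φ - (s • a₁ + t • a₂) = (s : 𝕜) • b₁ + (t : 𝕜) • b₂ := by
          rw [← hsum', ← hreal, ← hreal, smul_add, smul_add]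
          abel
        rw [this]
        exact Submodule.add_mem _ (Submodule.smul_mem _ _ hb₁) (Submodule.smul_mem _ _ hb₂)
    rw [hK.inf_eq_bot, Submodule.mem_bot] at hm
    exact (sub_eq_zero.1 hm).symm
  have m₁ : StrongDual.toWeakDual a₁ ∈ annihilatorBall J :=
    ⟨mem_dualUnitBall.2 (by change ‖a₁‖ ≤ 1; linarith [norm_nonneg b₁]), ha₁⟩
  have m₂ : StrongDual.toWeakDual a₂ ∈ annihilatorBall J :=
    ⟨mem_dualUnitBall.2 (by change ‖a₂‖ ≤ 1; linarith [norm_nonneg b₂]), ha₂⟩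
  have key : StrongDual.toWeakDual a₁ = Φ := hΦ.2 m₁ m₂ ⟨s, t, hs, ht, hst, hΦa⟩
  have key' : a₁ = WeakDual.toStrongDual Φ := key
  -- Now `‖a₁‖ = 1` already exhausts the bound `‖a₁‖ + ‖b₁‖ ≤ 1`.
  have hb : b₁ = 0 := by
    rw [key', hone] at n₁
    exact norm_le_zero_iff.1 (by linarith)
  rw [hb, add_zero] at e₁
  exact (WeakDual.toStrongDual (𝕜 := 𝕜)).injective (e₁.trans key')

/-- If all the extreme points of the unit ball of the annihilator of a closed subspace vanish at
`x`, then `x` belongs to the subspace. -/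
theorem mem_of_forall_extremePoints {J : Submodule 𝕜 X} (hJ : IsClosed (J : Set X)) {x : X}
    (hx : ∀ Φ ∈ (annihilatorBall J).extremePoints ℝ, Φ x = 0) : x ∈ J := by
  have hconv : Convex ℝ {φ : WeakDual 𝕜 X | φ x = 0} := by
    intro φ hφ ψ hψ a b _ _ _
    have hφ' : φ x = 0 := hφ
    have hψ' : ψ x = 0 := hψ
    change a • φ x + b • ψ x = 0
    rw [hφ', hψ', smul_zero, smul_zero, add_zero]
  have hall : annihilatorBall J ⊆ {φ : WeakDual 𝕜 X | φ x = 0} := by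
    refine (closure_convexHull_extremePoints_annihilatorBall J).symm.subset.trans ?_
    exact closure_minimal (convexHull_min hx hconv)
      (isClosed_eq (WeakDual.eval_continuous x) continuous_const)
  by_contra hn
  have : IsClosed (J : Set X) := hJ
  have hq : J.mkQL x ≠ 0 := fun h => hn ((Submodule.Quotient.mk_eq_zero J).1 h)
  obtain ⟨g, -, hg⟩ := exists_dual_vector 𝕜 (J.mkQL x) (by simpa using hq)
  set f : StrongDual 𝕜 X := g.comp J.mkQL with hf
  have hfJ : ∀ y ∈ J, f y = 0 := fun y hy => by
    have : J.mkQL y = 0 := (Submodule.Quotient.mk_eq_zero J).2 hy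
    rw [hf, ContinuousLinearMap.comp_apply, this, map_zero]
  have hfx : f x ≠ 0 := by
    rw [hf, ContinuousLinearMap.comp_apply, hg]
    simpa using hq
  set c : 𝕜 := ((1 + ‖f‖ : ℝ) : 𝕜)⁻¹ with hc
  have hpos : 0 < 1 + ‖f‖ := by positivity
  have hmem : StrongDual.toWeakDual (c • f) ∈ annihilatorBall J := by
    refine ⟨mem_dualUnitBall.2 ?_, fun y hy => ?_⟩
    · change ‖c • f‖ ≤ 1
      rw [norm_smul, hc, norm_inv, RCLike.norm_ofReal, abs_of_pos hpos, inv_mul_le_one₀ hpos]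
      linarith
    · change c • f y = 0
      rw [hfJ y hy, smul_zero]
  have h0 : c • f x = 0 := hall hmem
  rcases smul_eq_zero.1 h0 with h | h
  · rw [hc, inv_eq_zero, RCLike.ofReal_eq_zero] at h
    exact hpos.ne' h
  · exact hfx h

end LSummand

/-! ### Evaluations and powers of functionals -/

namespace HomPoly

variable {𝕜 : Type u} {E : Type v} [RCLike 𝕜] [NormedAddCommGroup E] [NormedSpace 𝕜 E] {n : ℕ}

@[simp] theorem sub_apply (P Q : HomPoly 𝕜 E n) (x : E) : (P - Q) x = P x - Q x := rfl

/-- The polynomial `x ↦ L (x, …, x)`. -/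
def ofMultilinear (L : ContinuousMultilinearMap 𝕜 (fun _ : Fin n => E) 𝕜) : HomPoly 𝕜 E n :=
  ⟨fun x => L (fun _ => x), L, fun _ => rfl⟩

@[simp] theorem ofMultilinear_apply (L : ContinuousMultilinearMap 𝕜 (fun _ : Fin n => E) 𝕜)
    (x : E) : ofMultilinear L x = L (fun _ => x) := rfl

theorem norm_apply_le (P : HomPoly 𝕜 E n) (x : E) : ‖P x‖ ≤ ‖x‖ ^ n * ‖P‖ := by
  rcases eq_or_ne x 0 with rfl | hx
  -- Degree zero is separate, since there `‖0‖ ^ n = 1`.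
  · rcases n.eq_zero_or_pos with rfl | hn
    · simpa using P.norm_apply_le_of_norm_le_one (x := 0) (by simp)
    · have h := P.map_smul_pow 0 0
      rw [zero_smul, zero_pow hn.ne', zero_mul] at h
      rw [h, norm_zero]
      positivity
  · have hx' : ((‖x‖ : ℝ) : 𝕜) ≠ 0 := by simpa using hx
    have h := P.map_smul_pow ((‖x‖ : ℝ) : 𝕜) ((((‖x‖ : ℝ) : 𝕜)⁻¹) • x)
    rw [smul_smul, mul_inv_cancel₀ hx', one_smul] at h
    rw [h, norm_mul, norm_pow, RCLike.norm_ofReal, abs_norm]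
    refine mul_le_mul_of_nonneg_left (P.norm_apply_le_of_norm_le_one ?_) (by positivity)
    simp [norm_smul, hx]

theorem norm_le_of_forall (P : HomPoly 𝕜 E n) {r : ℝ} (h : ∀ x, ‖x‖ ≤ 1 → ‖P x‖ ≤ r) :
    ‖P‖ ≤ r :=
  ciSup_le fun x => h x (mem_closedBall_zero_iff.1 x.2)

theorem apply_zero (hn : 1 ≤ n) (P : HomPoly 𝕜 E n) : P 0 = 0 := by
  have h := P.map_smul_pow 0 0
  rwa [zero_smul, zero_pow (by omega), zero_mul] at h

/-- Evaluation at a point, as a functional on the space of homogeneous polynomials. -/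
noncomputable def evalAt (𝕜 : Type u) {E : Type v} [RCLike 𝕜] [NormedAddCommGroup E]
    [NormedSpace 𝕜 E] (n : ℕ) (x : E) : StrongDual 𝕜 (HomPoly 𝕜 E n) :=
  LinearMap.mkContinuous
    { toFun := fun P => P x
      map_add' := fun _ _ => rfl
      map_smul' := fun _ _ => rfl } (‖x‖ ^ n) (fun P => P.norm_apply_le x)

@[simp] theorem evalAt_apply (x : E) (P : HomPoly 𝕜 E n) : evalAt 𝕜 n x P = P x := rfl

theorem norm_evalAt_le (x : E) : ‖evalAt 𝕜 n x‖ ≤ ‖x‖ ^ n :=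
  LinearMap.mkContinuous_norm_le _ (by positivity) _

/-- The polynomial `φ ^ n`, for `φ` in the dual. -/
noncomputable def powDual (n : ℕ) (φ : StrongDual 𝕜 E) : HomPoly 𝕜 E n :=
  ofMultilinear
    ((ContinuousMultilinearMap.mkPiAlgebraFin 𝕜 n 𝕜).compContinuousLinearMap fun _ => φ)

@[simp] theorem powDual_apply (φ : StrongDual 𝕜 E) (x : E) : powDual n φ x = φ x ^ n := by
  simp [powDual]

theorem powDual_mem (φ : StrongDual 𝕜 E) : powDual n φ ∈ weaklyContinuous 𝕜 E n := by
  intro B _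
  refine Continuous.continuousOn ?_
  simp only [powDual_apply]
  exact (WeakBilin.eval_continuous (topDualPairing 𝕜 E).flip φ).pow n

theorem norm_powDual_le {φ : StrongDual 𝕜 E} (hφ : ‖φ‖ ≤ 1) : ‖powDual n φ‖ ≤ 1 := by
  refine norm_le_of_forall _ fun x hx => ?_
  rw [powDual_apply, norm_pow]
  exact pow_le_one₀ (norm_nonneg _) ((φ.unit_le_opNorm x hx).trans hφ)

theorem exists_powDual (x : E) :
    ∃ Q ∈ weaklyContinuous 𝕜 E n, ‖Q‖ ≤ 1 ∧ ‖Q x‖ = ‖x‖ ^ n := by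
  obtain ⟨φ, hφ, hφx⟩ := exists_dual_vector'' 𝕜 x
  refine ⟨powDual n φ, powDual_mem φ, norm_powDual_le hφ, ?_⟩
  rw [powDual_apply, hφx, norm_pow, RCLike.norm_ofReal, abs_norm]

theorem norm_evalAt (x : E) : ‖evalAt 𝕜 n x‖ = ‖x‖ ^ n := by
  refine (norm_evalAt_le x).antisymm ?_
  obtain ⟨Q, -, hQ, hQx⟩ := exists_powDual (𝕜 := 𝕜) (n := n) x
  rw [← hQx, ← evalAt_apply]
  exact (evalAt 𝕜 n x).unit_le_opNorm Q hQ

theorem evalAt_mem {K : Submodule 𝕜 (StrongDual 𝕜 (HomPoly 𝕜 E n))}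
    (hK : IsCompl (topAnnihilator (weaklyContinuous 𝕜 E n)) K)
    (hL : ∀ φ ∈ topAnnihilator (weaklyContinuous 𝕜 E n), ∀ ψ ∈ K, ‖φ + ψ‖ = ‖φ‖ + ‖ψ‖) (x : E) :
    evalAt 𝕜 n x ∈ K := by
  obtain ⟨Q, hQJ, hQ, hQx⟩ := exists_powDual (𝕜 := 𝕜) (n := n) x
  exact mem_of_exists_norm_le hK hL ⟨Q, hQJ, hQ, by rw [norm_evalAt, evalAt_apply, hQx]⟩

/-! ### Weak limits and asymptotic additivity -/

theorem tendsto_weakSpace_iff {ι : Type*} {l : Filter ι} {x : ι → E} {a : E} :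
    Tendsto (fun i => toWeakSpace 𝕜 E (x i)) l (𝓝 (toWeakSpace 𝕜 E a)) ↔
      ∀ φ : StrongDual 𝕜 E, Tendsto (fun i => φ (x i)) l (𝓝 (φ a)) := by
  refine WeakBilin.tendsto_iff_forall_eval_tendsto (topDualPairing 𝕜 E).flip ?_
  intro y z hyz
  by_contra hne
  obtain ⟨φ, hφ⟩ := SeparatingDual.exists_separating_of_ne (R := 𝕜) hne
  exact hφ (LinearMap.congr_fun hyz φ)

theorem tendsto_of_mem_weaklyContinuous {P : HomPoly 𝕜 E n} (hP : P ∈ weaklyContinuous 𝕜 E n)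
    {ι : Type*} {l : Filter ι} {x : ι → E} {a : E} {C : ℝ} (hb : ∀ᶠ i in l, ‖x i‖ ≤ C)
    (hx : ∀ φ : StrongDual 𝕜 E, Tendsto (fun i => φ (x i)) l (𝓝 (φ a))) :
    Tendsto (fun i => P (x i)) l (𝓝 (P a)) := by
  -- The radius is enlarged so that the ball contains the limit `a` as well.
  have hcont := hP (Metric.closedBall 0 (max C ‖a‖)) Metric.isBounded_closedBall
    (toWeakSpace 𝕜 E a) ⟨a, by simp, rfl⟩
  have hlim : Tendsto (fun i => toWeakSpace 𝕜 E (x i)) l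
      (𝓝[toWeakSpace 𝕜 E '' Metric.closedBall 0 (max C ‖a‖)] (toWeakSpace 𝕜 E a)) := by
    refine tendsto_nhdsWithin_iff.2 ⟨tendsto_weakSpace_iff.2 hx, ?_⟩
    filter_upwards [hb] with i hi
    exact ⟨x i, by simp [hi], rfl⟩
  simpa [Function.comp_def] using Tendsto.comp hcont hlim

/-- The rotated evaluations at the points of the unit ball of `E`. -/
def rotatedEvals (𝕜 : Type u) (E : Type v) [RCLike 𝕜] [NormedAddCommGroup E]
    [NormedSpace 𝕜 E] (n : ℕ) : Set (WeakDual 𝕜 (HomPoly 𝕜 E n)) :=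
  (fun q : 𝕜 × E => StrongDual.toWeakDual (q.1 • evalAt 𝕜 n q.2)) ''
    {q : 𝕜 × E | ‖q.1‖ = 1 ∧ ‖q.2‖ ≤ 1}

theorem rotatedEvals_subset : rotatedEvals 𝕜 E n ⊆ dualUnitBall 𝕜 (HomPoly 𝕜 E n) := by
  rintro _ ⟨q, ⟨hq1, hq2⟩, rfl⟩
  refine mem_dualUnitBall.2 ?_
  change ‖q.1 • evalAt 𝕜 n q.2‖ ≤ 1
  rw [norm_smul, hq1, one_mul, norm_evalAt]
  exact pow_le_one₀ (norm_nonneg _) hq2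

theorem extremePoints_subset_closure_rotatedEvals :
    (dualUnitBall 𝕜 (HomPoly 𝕜 E n)).extremePoints ℝ ⊆ closure (rotatedEvals 𝕜 E n) := by
  refine extremePoints_dualUnitBall_subset_closure rotatedEvals_subset ?_ ?_
  · rintro c hc _ ⟨q, ⟨hq1, hq2⟩, rfl⟩
    exact ⟨(c * q.1, q.2), ⟨by rw [norm_mul, hc, hq1, one_mul], hq2⟩,
      mul_smul c q.1 (evalAt 𝕜 n q.2)⟩
  · intro Q r hr
    refine norm_le_of_forall Q fun x hx => ?_
    have h1 : ‖(1 : 𝕜) * Q x‖ ≤ r := hr _ ⟨(1, x), ⟨norm_one, hx⟩, rfl⟩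
    rwa [one_mul] at h1

/-- Extreme points of the dual unit ball are limits of rotated evaluations. -/
theorem exists_filter_of_mem_extremePoints {Φ : WeakDual 𝕜 (HomPoly 𝕜 E n)}
    (hΦ : Φ ∈ (dualUnitBall 𝕜 (HomPoly 𝕜 E n)).extremePoints ℝ) :
    ∃ l : Filter (𝕜 × E), l.NeBot ∧ (∀ᶠ q in l, ‖q.1‖ = 1 ∧ ‖q.2‖ ≤ 1) ∧
      ∀ Q : HomPoly 𝕜 E n, Tendsto (fun q : 𝕜 × E => q.1 * Q q.2) l (𝓝 (Φ Q)) := by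
  have hcl := extremePoints_subset_closure_rotatedEvals hΦ
  -- Neighbourhoods of `Φ` are pulled back to the pairs (rotation, point); membership in the closure
  -- makes this filter proper.
  refine ⟨comap (fun q : 𝕜 × E => StrongDual.toWeakDual (q.1 • evalAt 𝕜 n q.2)) (𝓝 Φ) ⊓
    𝓟 {q | ‖q.1‖ = 1 ∧ ‖q.2‖ ≤ 1}, ?_, mem_inf_of_right (mem_principal_self _), fun Q => ?_⟩
  · rw [mem_closure_iff_clusterPt, ClusterPt, rotatedEvals, ← map_principal,
      ← Filter.push_pull'] at hcl
    exact (map_neBot_iff _).1 hcl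
  · have h1 : Tendsto (fun q : 𝕜 × E => StrongDual.toWeakDual (q.1 • evalAt 𝕜 n q.2))
        (comap (fun q : 𝕜 × E => StrongDual.toWeakDual (q.1 • evalAt 𝕜 n q.2)) (𝓝 Φ)) (𝓝 Φ) :=
      tendsto_comap
    exact ((WeakDual.eval_continuous Q).tendsto Φ).comp (h1.mono_left inf_le_left)

/-- If the polynomials weakly continuous on bounded sets form an M-ideal, then weak continuity at
`0` on the unit ball implies weak continuity on bounded sets. -/
theorem mem_weaklyContinuous_of_tendsto_zero (hn : 1 ≤ n)
    (h : IsMIdeal (weaklyContinuous 𝕜 E n)) {P : HomPoly 𝕜 E n}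
    (hP : ∀ l : Filter E, (∀ᶠ x in l, ‖x‖ ≤ 1) →
      (∀ φ : StrongDual 𝕜 E, Tendsto φ l (𝓝 0)) → Tendsto P l (𝓝 0)) :
    P ∈ weaklyContinuous 𝕜 E n := by
  obtain ⟨hclosed, K, -, hK, hL⟩ := h
  refine mem_of_forall_extremePoints hclosed fun Φ hΦ => ?_
  rcases eq_or_ne Φ 0 with h0 | h0
  · rw [h0]
    rfl
  obtain ⟨l, hne, hlT, hlim⟩ :=
    exists_filter_of_mem_extremePoints (extremePoints_annihilatorBall hK hL hΦ h0)
  -- The rotations need not converge, so only moduli are compared.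
  have hnorm : ∀ Q : HomPoly 𝕜 E n, (fun q : 𝕜 × E => ‖q.1 * Q q.2‖) =ᶠ[l] fun q => ‖Q q.2‖ := by
    intro Q
    filter_upwards [hlT] with q hq
    rw [norm_mul, hq.1, one_mul]
  have hweak : ∀ φ : StrongDual 𝕜 E, Tendsto φ (map Prod.snd l) (𝓝 0) := by
    intro φ
    rw [tendsto_map'_iff]
    have h1 := (hlim (powDual n φ)).norm
    rw [hΦ.1.2 _ (powDual_mem φ), norm_zero] at h1
    have h2 := h1.congr' (hnorm _)
    simp only [powDual_apply, norm_pow] at h2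
    -- An `n`-th root turns `‖φ x‖ ^ n → 0` into `‖φ x‖ → 0`.
    have h3 := (h2.rpow_const (p := (n : ℝ)⁻¹) (Or.inr (by positivity)))
    have hn0 : n ≠ 0 := by omega
    rw [Real.zero_rpow (by positivity)] at h3
    refine tendsto_zero_iff_norm_tendsto_zero.2 (h3.congr fun q => ?_)
    exact Real.pow_rpow_inv_natCast (norm_nonneg _) hn0
  have hP0 : Tendsto (fun q : 𝕜 × E => P q.2) l (𝓝 0) := by
    refine tendsto_map'_iff.1 (hP (map Prod.snd l) ?_ hweak)
    exact eventually_map.2 (hlT.mono fun q hq => hq.2)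
  have h1 := (hlim P).norm.congr' (hnorm P)
  have h2 := tendsto_nhds_unique h1 (by simpa using hP0.norm)
  exact norm_eq_zero.1 h2

/-- Homogeneous polynomials are uniformly continuous on bounded sets. -/
theorem tendsto_sub_zero_of_bounded (P : HomPoly 𝕜 E n) {ι : Type*} {l : Filter ι} {x y : ι → E}
    {C : ℝ} (hx : ∀ᶠ i in l, ‖x i‖ ≤ C) (hxy : Tendsto (fun i => x i - y i) l (𝓝 0)) :
    Tendsto (fun i => P (x i) - P (y i)) l (𝓝 0) := by
  obtain ⟨L, hL⟩ := P.exists_multilinear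
  have hd := tendsto_zero_iff_norm_tendsto_zero.1 hxy
  -- Eventually `‖x i - y i‖ < 1`, so `C + 1` bounds both families in the multilinear Lipschitz
  -- estimate.
  refine squeeze_zero_norm' (a := fun i => ‖L‖ * n * (C + 1) ^ (n - 1) * ‖x i - y i‖) ?_ ?_
  · filter_upwards [hx, hd.eventually_lt_const one_pos] with i hi hi1
    have hC : 0 ≤ C := (norm_nonneg _).trans hi
    have hy : ‖y i‖ ≤ C + 1 := by
      have := norm_sub_norm_le (y i) (x i)
      rw [norm_sub_rev] at this
      linarith
    rw [hL, hL]
    refine (L.norm_image_sub_le _ _).trans ?_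
    have h1 : ‖(fun _ : Fin n => x i)‖ ≤ C + 1 :=
      (pi_norm_le_iff_of_nonneg (by linarith)).2 fun _ => by linarith
    have h2 : ‖(fun _ : Fin n => y i)‖ ≤ C + 1 :=
      (pi_norm_le_iff_of_nonneg (by linarith)).2 fun _ => hy
    have h3 : ‖(fun _ : Fin n => x i) - (fun _ => y i)‖ ≤ ‖x i - y i‖ :=
      (pi_norm_le_iff_of_nonneg (norm_nonneg _)).2 fun _ => le_rfl
    rw [Fintype.card_fin]
    gcongr
    exact max_le h1 h2
  · simpa using hd.const_mul (‖L‖ * n * (C + 1) ^ (n - 1))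

/-- Composition of a homogeneous polynomial with a continuous linear map. -/
theorem exists_comp (P : HomPoly 𝕜 E n) (T : E →L[𝕜] E) :
    ∃ Q : HomPoly 𝕜 E n, ∀ x, Q x = P (T x) := by
  obtain ⟨L, hL⟩ := P.exists_multilinear
  exact ⟨ofMultilinear (L.compContinuousLinearMap fun _ => T), fun x => by simp [hL]⟩

/-- If the polynomials weakly continuous on bounded sets form an M-ideal, then homogeneous
polynomials are asymptotically additive along bounded weakly null families. -/
theorem tendsto_add_sub (hn : 1 ≤ n) (h : IsMIdeal (weaklyContinuous 𝕜 E n))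
    (P : HomPoly 𝕜 E n) (v : E) {ι : Type*} {l : Filter ι} {x : ι → E} {C : ℝ}
    (hb : ∀ᶠ i in l, ‖x i‖ ≤ C) (hx : ∀ φ : StrongDual 𝕜 E, Tendsto (fun i => φ (x i)) l (𝓝 0)) :
    Tendsto (fun i => P (v + x i) - P (x i)) l (𝓝 (P v)) := by
  rcases eq_or_ne v 0 with rfl | hv
  · simpa [apply_zero hn] using tendsto_const_nhds
  obtain ⟨φ, hφ⟩ := SeparatingDual.exists_eq_one (R := 𝕜) hv
  obtain ⟨Q, hQ⟩ := P.exists_comp (ContinuousLinearMap.id 𝕜 E - φ.smulRight v)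
  have hQ' : ∀ y, Q y = P (y - φ y • v) := fun y => by rw [hQ]; rfl
  have hsmul : ∀ {κ : Type _} (m : Filter κ) (y : κ → E),
      Tendsto (fun i => φ (y i)) m (𝓝 0) →
        Tendsto (fun i => y i - (y i - φ (y i) • v)) m (𝓝 0) := by
    intro κ m y hy
    simpa using hy.smul_const v
  have hmem : P - Q ∈ weaklyContinuous 𝕜 E n := by
    refine mem_weaklyContinuous_of_tendsto_zero hn h fun m hm hm0 => ?_
    have := P.tendsto_sub_zero_of_bounded (x := fun y : E => y) hm (hsmul m _ (hm0 φ))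
    exact this.congr fun y => by rw [sub_apply, hQ']
  have h1 : Tendsto (fun i => (P - Q) (v + x i)) l (𝓝 ((P - Q) v)) := by
    refine tendsto_of_mem_weaklyContinuous hmem (C := ‖v‖ + C) ?_ fun ψ => ?_
    · filter_upwards [hb] with i hi
      exact (norm_add_le _ _).trans (by linarith)
    · simpa using (hx ψ).const_add (ψ v)
  have h2 := P.tendsto_sub_zero_of_bounded hb
    (y := fun i => x i - φ (x i) • v) (by simpa using (hx φ).smul_const v)
  have h3 : (P - Q) v = P v := by
    rw [sub_apply, hQ', hφ, one_smul, sub_self, apply_zero hn, sub_zero]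
  rw [h3] at h1
  have h4 := h1.sub h2
  rw [sub_zero] at h4
  refine h4.congr fun i => ?_
  -- The projection kills `v`, hence `Q (v + x i) = Q (x i)`.
  have : v + x i - φ (v + x i) • v = x i - φ (x i) • v := by
    rw [map_add, hφ, add_smul, one_smul]
    abel
  rw [sub_apply, hQ', this]
  abel

/-- Evaluations along a bounded family have a weak-star limit along any ultrafilter. -/
theorem exists_tendsto_eval {ι : Type*} (U : Ultrafilter ι) {x : ι → E} {C : ℝ}
    (hb : ∀ᶠ i in (U : Filter ι), ‖x i‖ ≤ C) :
    ∃ Φ : StrongDual 𝕜 (HomPoly 𝕜 E n),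
      ∀ P : HomPoly 𝕜 E n, Tendsto (fun i => P (x i)) U (𝓝 (Φ P)) := by
  -- Banach–Alaoglu: the evaluations stay in the dual ball of radius `C ^ n`.
  obtain ⟨Φ, -, hΦ⟩ := (WeakDual.isCompact_closedBall (𝕜 := 𝕜)
    (0 : StrongDual 𝕜 (HomPoly 𝕜 E n)) (C ^ n)).ultrafilter_le_nhds
    (U.map fun i => StrongDual.toWeakDual (evalAt 𝕜 n (x i))) (by
      rw [le_principal_iff]
      change ∀ᶠ i in (U : Filter ι), _
      filter_upwards [hb] with i hi
      change evalAt 𝕜 n (x i) ∈ Metric.closedBall 0 (C ^ n)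
      rw [mem_closedBall_zero_iff, norm_evalAt]
      gcongr)
  refine ⟨WeakDual.toStrongDual Φ, fun P => ?_⟩
  exact ((WeakDual.eval_continuous P).tendsto Φ).comp hΦ

/-! ### Property (M) -/

theorem hasPropertyM_of_isMIdeal (hn : 1 ≤ n) (h : IsMIdeal (weaklyContinuous 𝕜 E n))
    {P : HomPoly 𝕜 E n} (hP : ‖P‖ ≤ 1) : HasPropertyM.{u, v, w} P := by
  intro c v hcv ι _ _ _ x hbdd hweak
  obtain ⟨C, hC⟩ := hbdd.exists_norm_le
  replace hC : ∀ i, ‖x i‖ ≤ C := fun i => hC _ ⟨i, rfl⟩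
  have hCv : ∀ i, ‖v + x i‖ ≤ ‖v‖ + C := fun i =>
    (norm_add_le _ _).trans (by linarith [hC i])
  have hx : ∀ φ : StrongDual 𝕜 E, Tendsto (fun i => φ (x i)) atTop (𝓝 0) := by
    rw [← map_zero (toWeakSpace 𝕜 E)] at hweak
    intro φ
    simpa using tendsto_weakSpace_iff.1 hweak φ
  by_contra! hlt
  obtain ⟨r, hr1, hr2⟩ := exists_between hlt
  -- Two intermediate values are used because passing to limits makes both inequalities weak; the
  -- gap `s < r` keeps the contradiction strict.
  obtain ⟨s, hs1, hs2⟩ := exists_between hr1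
  have hcob : IsCoboundedUnder (· ≤ ·) atTop fun i => ‖c + P (x i)‖ :=
    (isBoundedUnder_of ⟨0, fun i => norm_nonneg (c + P (x i))⟩ :
      IsBoundedUnder (· ≥ ·) atTop fun i => ‖c + P (x i)‖).isCoboundedUnder_le
  have hbd : IsBoundedUnder (· ≤ ·) atTop fun i => ‖v + x i‖ ^ n :=
    isBoundedUnder_of ⟨(‖v‖ + C) ^ n, fun i => pow_le_pow_left₀ (norm_nonneg _) (hCv i) n⟩
  have hfreq := frequently_lt_of_lt_limsup hcob hr2
  have hev := eventually_lt_of_limsup_lt hs1 hbd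
  have : (atTop ⊓ 𝓟 {i | r < ‖c + P (x i)‖}).NeBot := frequently_mem_iff_neBot.1 hfreq
  set U := Ultrafilter.of (atTop ⊓ 𝓟 {i | r < ‖c + P (x i)‖}) with hUdef
  have hU := Ultrafilter.of_le (atTop ⊓ 𝓟 {i | r < ‖c + P (x i)‖})
  have hUtop : (U : Filter ι) ≤ atTop := hU.trans inf_le_left
  have hUr : ∀ᶠ i in (U : Filter ι), r < ‖c + P (x i)‖ :=
    hU (mem_inf_of_right (mem_principal_self _))
  obtain ⟨Ψ, hΨ⟩ := exists_tendsto_eval (𝕜 := 𝕜) (n := n) U (Eventually.of_forall hC)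
  obtain ⟨Φ, hΦ⟩ := exists_tendsto_eval (𝕜 := 𝕜) (n := n) U (Eventually.of_forall hCv)
  have hxU : ∀ φ : StrongDual 𝕜 E, Tendsto (fun i => φ (x i)) U (𝓝 0) := fun φ =>
    (hx φ).mono_left hUtop
  have hdecomp : Φ = Ψ + evalAt 𝕜 n v := by
    ext Q
    have h1 := tendsto_nhds_unique ((hΦ Q).sub (hΨ Q))
      (tendsto_add_sub hn h Q v (Eventually.of_forall hC) hxU)
    change Φ Q = Ψ Q + Q v
    rw [← h1, add_sub_cancel]
  have hΨJ : Ψ ∈ topAnnihilator (weaklyContinuous 𝕜 E n) := by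
    intro Q hQ
    have h1 := tendsto_of_mem_weaklyContinuous hQ (a := 0) (Eventually.of_forall hC)
      (fun φ => by simpa using hxU φ)
    rw [apply_zero hn] at h1
    exact tendsto_nhds_unique (hΨ Q) h1
  obtain ⟨-, K, -, hK, hL⟩ := h
  have hnormΦ : ‖Φ‖ = ‖Ψ‖ + ‖v‖ ^ n := by
    rw [hdecomp, hL Ψ hΨJ _ (evalAt_mem hK hL v), norm_evalAt]
  have hs0 : 0 ≤ s := by
    obtain ⟨i, hi⟩ := hev.exists
    exact (pow_nonneg (norm_nonneg _) n).trans hi.le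
  -- Eventually `‖Q (v + x i)‖ ≤ ‖v + x i‖ ^ n * ‖Q‖ ≤ s * ‖Q‖`.
  have hΦs : ‖Φ‖ ≤ s := by
    refine Φ.opNorm_le_bound hs0 fun Q => ?_
    refine le_of_tendsto (hΦ Q).norm ((hev.filter_mono hUtop).mono fun i hi => ?_)
    exact (Q.norm_apply_le _).trans (mul_le_mul_of_nonneg_right hi.le (norm_nonneg _))
  have hlow : r ≤ ‖c + Ψ P‖ :=
    ge_of_tendsto ((hΨ P).const_add c).norm (hUr.mono fun i hi => hi.le)
  have hΨP : ‖Ψ P‖ ≤ ‖Ψ‖ := Ψ.unit_le_opNorm P hP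
  have := norm_add_le c (Ψ P)
  -- The chain is `r ≤ ‖c‖ + ‖Ψ P‖ ≤ ‖v‖ ^ n + ‖Ψ‖ = ‖Φ‖ ≤ s < r`.
  linarith

end HomPoly

theorem proposition3p7 {𝕜 : Type u} {E : Type v} [RCLike 𝕜] [NormedAddCommGroup E]
    [NormedSpace 𝕜 E] [CompleteSpace E] (n : ℕ) (hn : 1 ≤ n)
    (h : IsMIdeal (HomPoly.weaklyContinuous 𝕜 E n)) :
    HasPolynomialPropertyM.{u, v, w} 𝕜 E n :=
  fun _ hP => HomPoly.hasPropertyM_of_isMIdeal hn h hP
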